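/- Let $\mathbb{T}$ be the unit circle with normalized Lebesgue measure $m$, and let $L^0$ be the space of (a.e. equivalence classes of) measurable complex-valued functions on $\mathbb{T}$. A Banach function space is a complex Banach space $X\subset L^0$ such that (a) if $f\in X$, $g\in L^0$ and $|g|\le|f|$ a.e., then $g\in X$ and $\|g\|_X\le\|f\|_X$; (b) $L^\infty\subset X$; (c) if $f_n,f\in X$ and $0\le f_n\uparrow f$ a.e., then $\|f\|_X=\sup_n\|f_n\|_X$. It is rearrangement invariant (r.i.) if, whenever $f\in X$ and $g\in L^0$ satisfy $m\{|f|>\lambda\}=m\{|g|>\lambda\}$ for all $\lambda\ge0$, then $g\in X$ and $\|g\|_X=\|f\|_X$. For sets $A,B\subset L^0$ equipped with functionals $\|\cdot\|_A,\|\cdot\|_B$, put $A\odot B=\{gh: g\in A,\ h\in B\}$ and $\|f\|_{A\odot B}=\inf\{\|g\|_A\|h\|_B: f=gh,\ g\in A,\ h\in B\}$. For $Z\subset L^1$ equipped with a functional $\|\cdot\|_Z$, put $H[Z]=\{f\in Z:\widehat f(n)=0\text{ for all integers }n<0\}$, with $\|f\|_{H[Z]}=\|f\|_Z$, where $\widehat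 f(n)=\int_{\mathbb T}f(t)\,t^{-n}\,dm(t)$. (Every r.i. Banach function space is contained in $L^1$.) Theorem. Let $X,Y$ be r.i. Banach function spaces on $\mathbb{T}$ with $X\odot Y\subset L^1$. Then $$H[X]\odot H[Y]\equiv H[X\odot Y],$$ that is, the two sides are equal as sets and $\|f\|_{H[X]\odot H[Y]}=\|f\|_{X\odot Y}$ for every $f$ in them. -/

import Mathlib

open MeasureTheory Filter Topology

instance fact_zero_lt_two_pi : Fact (0 < 2 * Real.pi) := ⟨Real.two_pi_pos⟩

/-- The circle `𝕋`, parametrised by the angle `θ ∈ ℝ / 2πℤ` (the point being `t = e^{iθ}`). -/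
abbrev Torus : Type := AddCircle (2 * Real.pi)

/-- The normalized Lebesgue measure on the circle. -/
noncomputable abbrev torusMeasure : Measure Torus := AddCircle.haarAddCircle

/-- `L⁰(𝕋, m)`: a.e.-classes of measurable complex-valued functions on the circle. -/
abbrev LZero : Type := Torus →ₘ[torusMeasure] ℂ

/-- A set of (classes of) functions on the circle together with a real functional.
Only the values of `nrm` on `carrier` are meaningful. -/
structure FunctionClass where
  carrier : Set LZero
  nrm : LZero → ℝ

/-- `f` and `g` are equimeasurable: `|f|` and `|g|` have the same distribution function. -/
def Equimeasurable (f g : LZero) : Prop :=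
  ∀ c : ℝ, 0 ≤ c → torusMeasure {t | c < ‖f t‖} = torusMeasure {t | c < ‖g t‖}

namespace FunctionClass

open scoped ComplexOrder in
/-- Banach function spaces on the circle: complex Banach spaces `X ⊆ L⁰` that have the ideal
property, contain `L^∞`, and have the semi-Fatou property. In the latter, inequalities between
complex numbers are those of the order in which `0 ≤ z` means that `z` is real and nonnegative. -/
structure IsBanachFunctionSpace (X : FunctionClass) : Prop where
  zero_mem : (0 : LZero) ∈ X.carrier
  add_mem : ∀ f ∈ X.carrier, ∀ g ∈ X.carrier, f + g ∈ X.carrier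
  smul_mem : ∀ (c : ℂ), ∀ f ∈ X.carrier, c • f ∈ X.carrier
  nrm_nonneg : ∀ f ∈ X.carrier, 0 ≤ X.nrm f
  nrm_eq_zero_iff : ∀ f ∈ X.carrier, (X.nrm f = 0 ↔ f = 0)
  nrm_smul : ∀ (c : ℂ), ∀ f ∈ X.carrier, X.nrm (c • f) = ‖c‖ * X.nrm f
  nrm_add_le : ∀ f ∈ X.carrier, ∀ g ∈ X.carrier, X.nrm (f + g) ≤ X.nrm f + X.nrm g
  complete : ∀ u : ℕ → LZero, (∀ n, u n ∈ X.carrier) →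
    (∀ ε : ℝ, 0 < ε → ∃ N : ℕ, ∀ m ≥ N, ∀ n ≥ N, X.nrm (u m - u n) < ε) →
    ∃ f ∈ X.carrier, Tendsto (fun n => X.nrm (u n - f)) atTop (𝓝 0)
  ideal : ∀ f ∈ X.carrier, ∀ g : LZero, (∀ᵐ t ∂torusMeasure, ‖g t‖ ≤ ‖f t‖) →
    g ∈ X.carrier ∧ X.nrm g ≤ X.nrm f
  linfty_subset : ∀ f : LZero, MemLp f ⊤ torusMeasure → f ∈ X.carrier
  semiFatou : ∀ (u : ℕ → LZero) (f : LZero), (∀ n, u n ∈ X.carrier) → f ∈ X.carrier →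
    (∀ᵐ t ∂torusMeasure, (∀ n, 0 ≤ u n t) ∧ Monotone (fun n => u n t) ∧
      Tendsto (fun n => u n t) atTop (𝓝 (f t))) →
    IsLUB (Set.range fun n => X.nrm (u n)) (X.nrm f)

/-- Rearrangement invariance. -/
def IsRearrangementInvariant (X : FunctionClass) : Prop :=
  ∀ f g : LZero, Equimeasurable f g → f ∈ X.carrier → g ∈ X.carrier ∧ X.nrm f = X.nrm g

/-- The inclusion `X ⊆ L¹`. -/
def SubsetLOne (X : FunctionClass) : Prop :=
  ∀ f ∈ X.carrier, Integrable f torusMeasure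

/-- The pointwise product `X ⊙ Y`, with `‖f‖ = inf {‖g‖_X ‖h‖_Y : f = g h, g ∈ X, h ∈ Y}`. -/
noncomputable def prod (X Y : FunctionClass) : FunctionClass where
  carrier := {f | ∃ g ∈ X.carrier, ∃ h ∈ Y.carrier, f = g * h}
  nrm f := sInf {r | ∃ g ∈ X.carrier, ∃ h ∈ Y.carrier, f = g * h ∧ r = X.nrm g * Y.nrm h}

/-- The Hardy space `H[X]`: the elements of `X` whose Fourier coefficients of negative index vanish,
with the functional of `X`. It is considered for `X ⊆ L¹`, where the integrability clause, which
makes the Fourier coefficients meaningful, holds automatically. -/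
noncomputable def hardy (X : FunctionClass) : FunctionClass where
  carrier := {f | f ∈ X.carrier ∧ Integrable f torusMeasure ∧ ∀ n : ℤ, n < 0 → fourierCoeff f n = 0}
  nrm := X.nrm

/-- `X ≡ Y`: the two classes have the same elements, with the same values of the functional. -/
def IsometricallyEqual (X Y : FunctionClass) : Prop :=
  X.carrier = Y.carrier ∧ ∀ f ∈ X.carrier, X.nrm f = Y.nrm f

end FunctionClass

/-! If `f = g h` is analytic with `g ∈ X`, `h ∈ Y`, let `G` be an outer function with `|G| =
max(|g|, δ)` and put `H = f / G`. Then `G` and `H` are analytic, `|H| ≤ |h|`, and `|G| ≤ |g| + δ`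
gives `‖G‖ ≤ ‖g‖ + δ‖1‖`. Letting `δ → 0` loses nothing in the norm. The floor `δ` makes `log |G|`
square-integrable and `1/G` bounded, so `log |g|` need not be integrable
(`exists_hardy_factorization`). Conversely, an integrable product of two `H¹` functions is in `H¹`
(`IsHardy.mul`).

The argument stays on the circle. An outer function is `exp F`, with `F` an `L²` limit of analytic
polynomials with real mean. Such an `F` is controlled by `Re F`, which can be any real `L²` function
bounded above, up to sign any log-modulus needed here (`exists_realMeanHardy_of_le`). An upper bound
on `Re F` dominates the exponentials of the polynomials, so multiplication by `exp F` preserves `H¹`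
(`IsHardy.exp_mul`). Unbounded cases are reached by multiplying with the cutoffs of `exists_cutoff`.
-/

/-! ### The Hardy space of the circle -/

/-- The Hardy class `H¹`: integrable functions whose Fourier coefficients of negative index vanish. -/
def IsHardy (f : Torus → ℂ) : Prop :=
  Integrable f torusMeasure ∧ ∀ n : ℤ, n < 0 → fourierCoeff f n = 0

theorem norm_fourier_apply (n : ℤ) (t : Torus) : ‖(fourier n t : ℂ)‖ = 1 := Circle.norm_coe _

theorem fourier_one_pow (k : ℕ) (t : Torus) : (fourier 1 t : ℂ) ^ k = fourier (k : ℤ) t := by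
  induction k with
  | zero => simp
  | succ k ih => rw [pow_succ, ih, Nat.cast_succ, fourier_add]

theorem integral_fourier_eq_ite (n : ℤ) :
    ∫ t, (fourier n t : ℂ) ∂torusMeasure = if n = 0 then 1 else 0 := by
  split_ifs with h
  · simp [h]
  · exact integral_eq_zero_of_add_right_eq_neg (μ := torusMeasure)
      (fourier_add_half_inv_index h Real.two_pi_pos)

theorem IsHardy.congr {f g : Torus → ℂ} (hf : IsHardy f) (h : f =ᵐ[torusMeasure] g) :
    IsHardy g :=
  ⟨hf.1.congr h, fun n hn => by rw [← fourierCoeff_congr_ae h, hf.2 n hn]⟩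

theorem IsHardy.add {f g : Torus → ℂ} (hf : IsHardy f) (hg : IsHardy g) :
    IsHardy (fun t => f t + g t) :=
  ⟨hf.1.add hg.1, fun n hn => by
    have := congrFun (fourierCoeff.add hf.1 hg.1) n
    simp only [Pi.add_apply, hf.2 n hn, hg.2 n hn, add_zero] at this
    exact this⟩

theorem IsHardy.const_mul {f : Torus → ℂ} (hf : IsHardy f) (c : ℂ) :
    IsHardy (fun t => c * f t) :=
  ⟨hf.1.const_mul c, fun n hn => by rw [fourierCoeff.const_mul, hf.2 n hn, mul_zero]⟩

theorem IsHardy.fourier_mul {f : Torus → ℂ} (hf : IsHardy f) (k : ℕ) :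
    IsHardy (fun t => fourier (k : ℤ) t * f t) := by
  refine ⟨hf.1.fourier_smul k, fun n hn => ?_⟩
  rw [← hf.2 (n - k) (by omega), fourierCoeff, fourierCoeff]
  congr 1 with t
  rw [neg_sub, sub_eq_neg_add, fourier_add, smul_eq_mul, smul_eq_mul, mul_assoc]

theorem IsHardy.polynomial_mul {f : Torus → ℂ} (hf : IsHardy f) (p : Polynomial ℂ) :
    IsHardy (fun t => p.eval (fourier 1 t) * f t) := by
  induction p using Polynomial.induction_on' with
  | add p q hp hq => simpa only [Polynomial.eval_add, add_mul] using hp.add hq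
  | monomial k c =>
    simpa only [Polynomial.eval_monomial, fourier_one_pow, mul_assoc] using
      (hf.fourier_mul k).const_mul c

theorem isHardy_one : IsHardy (fun _ => 1) := by
  refine ⟨integrable_const _, fun n hn => ?_⟩
  simp only [fourierCoeff, smul_eq_mul, mul_one]
  rw [integral_fourier_eq_ite, if_neg (by omega)]

/-- `H¹` is stable under dominated pointwise limits. -/
theorem IsHardy.of_tendsto {F : ℕ → Torus → ℂ} {f : Torus → ℂ} (b : Torus → ℝ)
    (hF : ∀ n, IsHardy (F n)) (hb : Integrable b torusMeasure)
    (hbound : ∀ n, ∀ᵐ t ∂torusMeasure, ‖F n t‖ ≤ b t)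
    (hlim : ∀ᵐ t ∂torusMeasure, Tendsto (fun n => F n t) atTop (𝓝 (f t))) : IsHardy f := by
  have hmeas : AEStronglyMeasurable f torusMeasure :=
    aestronglyMeasurable_of_tendsto_ae atTop (fun n => (hF n).1.1) hlim
  have hint : Integrable f torusMeasure := by
    refine hb.mono' hmeas ?_
    filter_upwards [hlim, ae_all_iff.2 hbound] with t ht hbt
    exact le_of_tendsto ht.norm (Eventually.of_forall hbt)
  refine ⟨hint, fun k hk => ?_⟩
  have h := tendsto_integral_of_dominated_convergence (μ := torusMeasure)
    (F := fun n t => fourier (-k) t • F n t) (f := fun t => fourier (-k) t • f t) b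
    (fun n => ((hF n).1.fourier_smul (-k)).1) hb
    (fun n => by
      filter_upwards [hbound n] with t ht
      rwa [norm_smul, norm_fourier_apply, one_mul])
    (by filter_upwards [hlim] with t ht using ht.const_smul _)
  have h0 : ∀ n, ∫ t, fourier (-k) t • F n t ∂torusMeasure = 0 := fun n => (hF n).2 k hk
  simp only [h0] at h
  exact tendsto_nhds_unique h tendsto_const_nhds

/-- The partial sums of the exponential series are again polynomials in `e^{it}`, dominated by `e^C`
with `C` a bound for `|p|` on the circle. -/
theorem IsHardy.exp_polynomial_mul {f : Torus → ℂ} (hf : IsHardy f) (p : Polynomial ℂ) :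
    IsHardy (fun t => Complex.exp (p.eval (fourier 1 t)) * f t) := by
  obtain ⟨C, hC⟩ : ∃ C : ℝ, ∀ t : Torus, ‖p.eval (fourier 1 t : ℂ)‖ ≤ C := by
    obtain ⟨C, hC⟩ := isCompact_univ.exists_bound_of_continuousOn
      (f := fun t : Torus => p.eval (fourier 1 t : ℂ))
      (p.continuous.comp (fourier 1).continuous).continuousOn
    exact ⟨C, fun t => hC t trivial⟩
  refine IsHardy.of_tendsto
    (F := fun n t => (∑ k ∈ Finset.range n, Polynomial.C ((k.factorial : ℂ)⁻¹) * p ^ k).eval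
      (fourier 1 t) * f t) (fun t => Real.exp C * ‖f t‖)
    (fun n => hf.polynomial_mul _) (hf.1.norm.const_mul _)
    (fun n => ae_of_all _ fun t => ?_) (ae_of_all _ fun t => ?_)
  · rw [norm_mul]
    gcongr
    rw [Polynomial.eval_finsetSum]
    refine (norm_sum_le _ _).trans (le_trans ?_ (Real.sum_le_exp_of_nonneg
      ((norm_nonneg _).trans (hC t)) n))
    refine Finset.sum_le_sum fun k _ => ?_
    rw [Polynomial.eval_mul, Polynomial.eval_C, Polynomial.eval_pow, norm_mul, norm_inv,
      norm_pow, Complex.norm_natCast, ← div_eq_inv_mul]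
    gcongr
    exact hC t
  · refine Tendsto.mul_const _ ?_
    have h := (NormedSpace.expSeries_div_hasSum_exp (p.eval (fourier 1 t : ℂ))).tendsto_sum_nat
    rw [← Complex.exp_eq_exp_ℂ] at h
    refine h.congr fun n => ?_
    rw [Polynomial.eval_finsetSum]
    refine Finset.sum_congr rfl fun k _ => ?_
    rw [Polynomial.eval_mul, Polynomial.eval_C, Polynomial.eval_pow, div_eq_inv_mul]

/-- The product of two functions of `H²` belongs to `H¹`. -/
theorem IsHardy.mul_of_memLp_two {f g : Torus → ℂ} (hf : IsHardy f) (hg : IsHardy g)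
    (hf2 : MemLp f 2 torusMeasure) (hg2 : MemLp g 2 torusMeasure) :
    IsHardy (fun t => f t * g t) := by
  refine ⟨hf2.integrable_mul hg2, fun n hn => ?_⟩
  -- The `n`-th coefficient of `f g` is the inner product of this function with `g`. Expanding `g`
  -- in its Fourier series, the term of index `i ≥ 0` carries the `n`-th coefficient of `e_i f`,
  -- which is zero.
  have ha : MemLp (fun t => (starRingEnd ℂ) (fourier (-n) t * f t)) 2 torusMeasure := by
    refine hf2.of_le (Complex.continuous_conj.comp_aestronglyMeasurable
      (((fourier (-n)).continuous.aestronglyMeasurable).mul hf2.1)) (ae_of_all _ fun t => ?_)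
    rw [RCLike.norm_conj, norm_mul, norm_fourier_apply, one_mul]
  have hcoef : ∀ i : ℤ, fourierCoeff (hg2.toLp g) i = fourierCoeff g i := fun i => by
    rw [fourierCoeff_congr_ae hg2.coeFn_toLp]
  have hs := (hasSum_fourier_series_L2 (hg2.toLp g)).mapL (innerSL ℂ (ha.toLp _))
  have hzero : ∀ i : ℤ, innerSL ℂ (ha.toLp _) (fourierCoeff (hg2.toLp g) i • fourierLp 2 i) = 0 := by
    intro i
    rw [hcoef]
    rcases lt_or_ge i 0 with hi | hi
    · rw [hg.2 i hi, zero_smul, map_zero]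
    · lift i to ℕ using hi
      rw [map_smul, innerSL_apply_apply, L2.inner_def]
      convert smul_zero _
      rw [← (hf.fourier_mul i).2 n hn, fourierCoeff]
      refine integral_congr_ae ?_
      filter_upwards [ha.coeFn_toLp, coeFn_fourierLp (T := 2 * Real.pi) 2 (i : ℤ)] with t h1 h2
      rw [h1, h2, RCLike.inner_apply, RingHomCompTriple.comp_apply, RingHom.id_apply, smul_eq_mul]
      ring
  simp only [hzero] at hs
  have h0 := hs.unique hasSum_zero
  rw [innerSL_apply_apply, L2.inner_def] at h0
  rw [← h0, fourierCoeff]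
  refine integral_congr_ae ?_
  filter_upwards [ha.coeFn_toLp, hg2.coeFn_toLp] with t h1 h2
  rw [h1, h2, RCLike.inner_apply, RingHomCompTriple.comp_apply, RingHom.id_apply, smul_eq_mul]
  ring

/-! ### Analytic completion of real square-integrable functions -/

/-- The analytic trigonometric polynomial `t ↦ p(e^{it})`. -/
noncomputable def circlePolynomial (p : Polynomial ℂ) : C(Torus, ℂ) where
  toFun t := p.eval (fourier 1 t)
  continuous_toFun := p.continuous.comp (fourier 1).continuous

@[simp]
theorem circlePolynomial_apply (p : Polynomial ℂ) (t : Torus) :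
    circlePolynomial p t = p.eval (fourier 1 t) := rfl

/-- The class in `L²` of an analytic trigonometric polynomial. -/
noncomputable def circlePolynomialLp (p : Polynomial ℂ) : Lp ℂ 2 torusMeasure :=
  ContinuousMap.toLp 2 torusMeasure ℂ (circlePolynomial p)

theorem coeFn_circlePolynomialLp (p : Polynomial ℂ) :
    circlePolynomialLp p =ᵐ[torusMeasure] fun t => p.eval (fourier 1 t : ℂ) :=
  ContinuousMap.coeFn_toLp torusMeasure (circlePolynomial p)

/-- The mean of an analytic trigonometric polynomial is its constant coefficient. -/
theorem integral_eval_fourier_one (p : Polynomial ℂ) :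
    ∫ t, p.eval (fourier 1 t : ℂ) ∂torusMeasure = p.eval 0 := by
  have hint : ∀ q : Polynomial ℂ, Integrable (fun t => q.eval (fourier 1 t : ℂ)) torusMeasure :=
    fun q => (isHardy_one.polynomial_mul q).1.congr (ae_of_all _ fun t => mul_one _)
  induction p using Polynomial.induction_on' with
  | add p q hp hq =>
    simp only [Polynomial.eval_add]
    rw [integral_add (hint p) (hint q), hp, hq]
  | monomial k c =>
    simp only [Polynomial.eval_monomial, fourier_one_pow]
    rw [integral_const_mul, integral_fourier_eq_ite]
    rcases eq_or_ne k 0 with rfl | hk <;> simp [*]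

/-- Every real part of a trigonometric polynomial is the real part of an analytic one, with real
constant coefficient. -/
theorem exists_polynomial_re_eq {q : C(Torus, ℂ)}
    (hq : q ∈ Submodule.span ℂ (Set.range (@fourier (2 * Real.pi)))) :
    ∃ p : Polynomial ℂ, (p.eval 0).im = 0 ∧
      ∀ t : Torus, (p.eval (fourier 1 t : ℂ)).re = (q t).re := by
  -- Taking real parts is not complex-linear, so the scalar is built into the induction.
  suffices h : ∀ c : ℂ, ∃ p : Polynomial ℂ, (p.eval 0).im = 0 ∧
      ∀ t : Torus, (p.eval (fourier 1 t : ℂ)).re = (c * q t).re by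
    simpa only [one_mul] using h 1
  induction hq using Submodule.span_induction with
  | mem x hx =>
    obtain ⟨n, rfl⟩ := hx
    intro c
    rcases lt_trichotomy n 0 with hn | rfl | hn
    · obtain ⟨k, rfl⟩ := Int.exists_eq_neg_ofNat hn.le
      have hk : k ≠ 0 := by rintro rfl; simp at hn
      -- Conjugation preserves the real part and turns the frequency `-k` into `k`.
      refine ⟨Polynomial.C ((starRingEnd ℂ) c) * Polynomial.X ^ k, by simp [hk], fun t => ?_⟩
      rw [Polynomial.eval_mul, Polynomial.eval_C, Polynomial.eval_pow, Polynomial.eval_X,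
        fourier_one_pow, fourier_neg, ← Complex.conj_re, map_mul, Complex.conj_conj]
    · exact ⟨Polynomial.C (c.re : ℂ), by simp, fun t => by simp⟩
    · lift n to ℕ using hn.le
      have hk : n ≠ 0 := by rintro rfl; simp at hn
      refine ⟨Polynomial.C c * Polynomial.X ^ n, by simp [hk], fun t => ?_⟩
      rw [Polynomial.eval_mul, Polynomial.eval_C, Polynomial.eval_pow, Polynomial.eval_X,
        fourier_one_pow]
  | zero => exact fun c => ⟨0, by simp, fun t => by simp⟩
  | add x y _ _ hx hy =>
    intro c
    obtain ⟨p, hp0, hp⟩ := hx c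
    obtain ⟨r, hr0, hr⟩ := hy c
    refine ⟨p + r, by simp [hp0, hr0], fun t => ?_⟩
    rw [Polynomial.eval_add, Complex.add_re, hp, hr, ContinuousMap.add_apply, mul_add,
      Complex.add_re]
  | smul a x _ hx =>
    intro c
    obtain ⟨p, hp0, hp⟩ := hx (c * a)
    exact ⟨p, hp0, fun t => by rw [hp, ContinuousMap.smul_apply, smul_eq_mul, mul_assoc]⟩

/-- The real subspace of `L²` of analytic trigonometric polynomials with real mean. -/
noncomputable def realMeanPolynomials : Submodule ℝ (Lp ℂ 2 torusMeasure) where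
  carrier := {F | ∃ p : Polynomial ℂ, (p.eval 0).im = 0 ∧ F = circlePolynomialLp p}
  zero_mem' := ⟨0, by simp, by
    rw [circlePolynomialLp, show circlePolynomial 0 = 0 by ext; simp, map_zero]⟩
  add_mem' := by
    rintro _ _ ⟨p, hp, rfl⟩ ⟨q, hq, rfl⟩
    refine ⟨p + q, by simp [hp, hq], ?_⟩
    rw [circlePolynomialLp, circlePolynomialLp, circlePolynomialLp, ← map_add]
    congr 1
    ext t
    simp
  smul_mem' := by
    rintro c _ ⟨p, hp, rfl⟩
    refine ⟨Polynomial.C (c : ℂ) * p, by simp [hp], ?_⟩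
    refine Lp.ext ?_
    filter_upwards [Lp.coeFn_smul c (circlePolynomialLp p), coeFn_circlePolynomialLp p,
      coeFn_circlePolynomialLp (Polynomial.C (c : ℂ) * p)] with t h1 h2 h3
    rw [h1, h3, Pi.smul_apply, h2, Polynomial.eval_mul, Polynomial.eval_C, Complex.real_smul]

/-- The real subspace of `H²` of functions with real mean. -/
noncomputable def realMeanHardy : Submodule ℝ (Lp ℂ 2 torusMeasure) :=
  realMeanPolynomials.topologicalClosure

/-- The real part, as an operator on `L²`. -/
noncomputable def reLp : Lp ℂ 2 torusMeasure →L[ℝ] Lp ℝ 2 torusMeasure :=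
  Complex.reCLM.compLpL 2 torusMeasure

theorem coeFn_reLp (F : Lp ℂ 2 torusMeasure) :
    reLp F =ᵐ[torusMeasure] fun t => (F t).re :=
  ContinuousLinearMap.coeFn_compLpL _ _

theorem circlePolynomialLp_mem {p : Polynomial ℂ} (hp : (p.eval 0).im = 0) :
    circlePolynomialLp p ∈ realMeanHardy :=
  Submodule.le_topologicalClosure _ ⟨p, hp, rfl⟩

theorem norm_sq_eq_integral {E : Type*} [NormedAddCommGroup E] [InnerProductSpace ℝ E]
    (F : Lp E 2 torusMeasure) : ‖F‖ ^ 2 = ∫ t, ‖F t‖ ^ 2 ∂torusMeasure := by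
  rw [← real_inner_self_eq_norm_sq, L2.inner_def]
  simp only [real_inner_self_eq_norm_sq]

/-- Integrate `2 (Re p)² - |p|² = Re (p²)`. The mean of `p²` is `p(0)²`, which is nonnegative
because `p(0)` is real. -/
theorem norm_sq_circlePolynomialLp_le {p : Polynomial ℂ} (hp : (p.eval 0).im = 0) :
    ‖circlePolynomialLp p‖ ^ 2 ≤ 2 * ‖reLp (circlePolynomialLp p)‖ ^ 2 := by
  set e : Torus → ℂ := fun t => p.eval (fourier 1 t : ℂ) with he
  have hc : Continuous e := (circlePolynomial p).continuous
  have hi : ∀ {φ : Torus → ℝ}, Continuous φ → Integrable φ torusMeasure := fun h =>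
    h.integrable_of_hasCompactSupport (HasCompactSupport.of_compactSpace _)
  have h1 : ‖circlePolynomialLp p‖ ^ 2 = ∫ t, ‖e t‖ ^ 2 ∂torusMeasure := by
    rw [norm_sq_eq_integral]
    refine integral_congr_ae ?_
    filter_upwards [coeFn_circlePolynomialLp p] with t ht
    rw [ht]
  have h2 : ‖reLp (circlePolynomialLp p)‖ ^ 2 = ∫ t, (e t).re ^ 2 ∂torusMeasure := by
    rw [norm_sq_eq_integral]
    refine integral_congr_ae ?_
    filter_upwards [coeFn_circlePolynomialLp p, coeFn_reLp (circlePolynomialLp p)] with t ht ht'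
    rw [ht', ht, Real.norm_eq_abs, sq_abs]
  have h3 : ∫ t, (e t ^ 2).re ∂torusMeasure = (p.eval 0).re ^ 2 := by
    have h4 : ∫ t, e t ^ 2 ∂torusMeasure = (p.eval 0) ^ 2 := by
      have := integral_eval_fourier_one (p ^ 2)
      simp_rw [Polynomial.eval_pow] at this
      exact this
    have h5 : Integrable (fun t => e t ^ 2) torusMeasure :=
      (hc.pow 2).integrable_of_hasCompactSupport (HasCompactSupport.of_compactSpace _)
    have h6 : ∫ t, (e t ^ 2).re ∂torusMeasure = (∫ t, e t ^ 2 ∂torusMeasure).re :=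
      integral_re h5
    rw [h6, h4, sq, sq, Complex.mul_re, hp]
    ring
  have h7 : 2 * ∫ t, (e t).re ^ 2 ∂torusMeasure - ∫ t, ‖e t‖ ^ 2 ∂torusMeasure =
      (p.eval 0).re ^ 2 := by
    rw [← h3, ← integral_const_mul, ← integral_sub (hi (by fun_prop)) (hi (by fun_prop))]
    congr 1 with t
    rw [Complex.sq_norm, Complex.normSq_apply, sq (e t), Complex.mul_re]
    ring
  rw [h1, h2]
  linarith [sq_nonneg (p.eval 0).re]

/-- An analytic function with real mean is controlled by its real part. -/
theorem norm_sq_le_of_mem_realMeanHardy {F : Lp ℂ 2 torusMeasure} (hF : F ∈ realMeanHardy) :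
    ‖F‖ ^ 2 ≤ 2 * ‖reLp F‖ ^ 2 := by
  have hclosed : IsClosed {F : Lp ℂ 2 torusMeasure | ‖F‖ ^ 2 ≤ 2 * ‖reLp F‖ ^ 2} :=
    isClosed_le (by fun_prop) (by fun_prop)
  refine hclosed.closure_subset_iff.2 ?_ hF
  rintro _ ⟨p, hp, rfl⟩
  exact norm_sq_circlePolynomialLp_le hp

theorem norm_le_of_mem_realMeanHardy {F : Lp ℂ 2 torusMeasure} (hF : F ∈ realMeanHardy) :
    ‖F‖ ≤ 2 * ‖reLp F‖ := by
  have h := norm_sq_le_of_mem_realMeanHardy hF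
  refine le_of_sq_le_sq ?_ (by positivity)
  nlinarith [sq_nonneg ‖reLp F‖]

/-- A square-integrable function bounded above is approximated in `L²` by real parts of analytic
polynomials with almost the same upper bound. -/
theorem exists_polynomial_approx (u : Lp ℝ 2 torusMeasure) {M : ℝ}
    (hu : ∀ᵐ t ∂torusMeasure, u t ≤ M) {ε : ℝ} (hε : 0 < ε) :
    ∃ p : Polynomial ℂ, (p.eval 0).im = 0 ∧ (∀ t : Torus, (p.eval (fourier 1 t : ℂ)).re ≤ M + 1) ∧
      ‖reLp (circlePolynomialLp p) - u‖ < ε := by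
  obtain ⟨φ, hφ⟩ := (ContinuousMap.toLp_denseRange ℝ torusMeasure ℝ
    (p := 2) (by simp)).exists_dist_lt u (half_pos hε)
  rw [dist_comm, dist_eq_norm] at hφ
  let ψ : C(Torus, ℂ) := ⟨fun t => ((min (φ t) M : ℝ) : ℂ), by fun_prop⟩
  have hψ : ψ ∈ closure (Submodule.span ℂ (Set.range (@fourier (2 * Real.pi))) : Set _) := by
    rw [← Submodule.topologicalClosure_coe, span_fourier_closure_eq_top]
    trivial
  -- The bound `1` keeps the real part below `M + 1`; the bound `ε / 2` controls the `L²` error.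
  obtain ⟨q, hq, hqψ⟩ := Metric.mem_closure_iff.1 hψ (min 1 (ε / 2)) (by positivity)
  obtain ⟨p, hp0, hp⟩ := exists_polynomial_re_eq hq
  have hclose : ∀ t, |(p.eval (fourier 1 t : ℂ)).re - min (φ t) M| ≤ min 1 (ε / 2) := fun t => by
    have h1 : ‖q t - ψ t‖ ≤ min 1 (ε / 2) := by
      rw [← dist_eq_norm, dist_comm]
      exact (ContinuousMap.dist_apply_le_dist t).trans hqψ.le
    have h2 := (Complex.abs_re_le_norm _).trans h1
    rwa [Complex.sub_re, ← hp, show (ψ t).re = min (φ t) M from Complex.ofReal_re _] at h2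
  refine ⟨p, hp0, fun t => ?_, ?_⟩
  · have := (abs_le.1 (hclose t)).2
    linarith [min_le_left 1 (ε / 2), min_le_right (φ t) M]
  · let w : C(Torus, ℝ) := ⟨fun t => min (φ t) M, by fun_prop⟩
    -- Since `u ≤ M`, truncating `φ` at `M` only brings it closer to `u`.
    have hw : ‖ContinuousMap.toLp 2 torusMeasure ℝ w - u‖ ≤
        ‖ContinuousMap.toLp 2 torusMeasure ℝ φ - u‖ := by
      refine Lp.norm_le_norm_of_ae_le ?_
      filter_upwards [Lp.coeFn_sub (ContinuousMap.toLp 2 torusMeasure ℝ w) u,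
        Lp.coeFn_sub (ContinuousMap.toLp 2 torusMeasure ℝ φ) u,
        ContinuousMap.coeFn_toLp (p := 2) (𝕜 := ℝ) torusMeasure w,
        ContinuousMap.coeFn_toLp (p := 2) (𝕜 := ℝ) torusMeasure φ, hu] with t h1 h2 h3 h4 h5
      rw [h1, h2, Pi.sub_apply, Pi.sub_apply, h3, h4]
      change |min (φ t) M - u t| ≤ |φ t - u t|
      rcases le_total (φ t) M with h | h
      · rw [min_eq_left h]
      · rw [min_eq_right h, abs_of_nonneg (by linarith), abs_of_nonneg (by linarith)]
        linarith
    have hpw : ‖reLp (circlePolynomialLp p) - ContinuousMap.toLp 2 torusMeasure ℝ w‖ ≤ ε / 2 := by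
      have h := Lp.norm_le_of_ae_bound (p := 2) (μ := torusMeasure) (C := ε / 2)
        (f := reLp (circlePolynomialLp p) - ContinuousMap.toLp 2 torusMeasure ℝ w)
        (by positivity) (by
          filter_upwards [Lp.coeFn_sub (reLp (circlePolynomialLp p))
              (ContinuousMap.toLp 2 torusMeasure ℝ w),
            coeFn_reLp (circlePolynomialLp p), coeFn_circlePolynomialLp p,
            ContinuousMap.coeFn_toLp (p := 2) (𝕜 := ℝ) torusMeasure w] with t h1 h2 h3 h4
          rw [h1, Pi.sub_apply, h2, h3, h4]
          exact (hclose t).trans (min_le_right _ _))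
      simpa [measureUnivNNReal] using h
    calc ‖reLp (circlePolynomialLp p) - u‖
        ≤ ‖reLp (circlePolynomialLp p) - ContinuousMap.toLp 2 torusMeasure ℝ w‖ +
          ‖ContinuousMap.toLp 2 torusMeasure ℝ w - u‖ := norm_sub_le_norm_sub_add_norm_sub _ _ _
      _ < ε := by linarith

/-- A square-integrable function `u` bounded above is the real part of an analytic function, which
is the limit of analytic polynomials whose real parts have almost the same upper bound. -/
theorem exists_realMeanHardy_of_le (u : Lp ℝ 2 torusMeasure) {M : ℝ}
    (hu : ∀ᵐ t ∂torusMeasure, u t ≤ M) :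
    ∃ F ∈ realMeanHardy, reLp F = u ∧ ∃ p : ℕ → Polynomial ℂ,
      (∀ n, ∀ t : Torus, ((p n).eval (fourier 1 t : ℂ)).re ≤ M + 1) ∧
      Tendsto (fun n => circlePolynomialLp (p n)) atTop (𝓝 F) := by
  have hε : ∀ n : ℕ, (0 : ℝ) < 1 / ((n : ℝ) + 1) := fun n => Nat.one_div_pos_of_nat
  choose p hp0 hpM hp using fun n => exists_polynomial_approx u hu (hε n)
  have hre : Tendsto (fun n => reLp (circlePolynomialLp (p n))) atTop (𝓝 u) := by
    rw [tendsto_iff_norm_sub_tendsto_zero]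
    exact squeeze_zero (fun _ => norm_nonneg _) (fun n => (hp n).le)
      tendsto_one_div_add_atTop_nhds_zero_nat
  -- The real parts converge, and they control differences of analytic polynomials with real mean.
  have hcauchy : CauchySeq fun n => circlePolynomialLp (p n) := by
    rw [Metric.cauchySeq_iff']
    intro ε hε
    obtain ⟨N, hN⟩ := Metric.cauchySeq_iff'.1 hre.cauchySeq (ε / 2) (half_pos hε)
    refine ⟨N, fun n hn => ?_⟩
    have h := norm_le_of_mem_realMeanHardy (realMeanHardy.sub_mem
      (circlePolynomialLp_mem (hp0 n)) (circlePolynomialLp_mem (hp0 N)))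
    have h' := hN n hn
    rw [dist_eq_norm] at h' ⊢
    rw [map_sub] at h
    linarith
  obtain ⟨F, hF⟩ := cauchySeq_tendsto_of_complete hcauchy
  have hmem : F ∈ realMeanHardy :=
    realMeanPolynomials.isClosed_topologicalClosure.mem_of_tendsto hF
      (Eventually.of_forall fun n => circlePolynomialLp_mem (hp0 n))
  exact ⟨F, hmem, tendsto_nhds_unique ((reLp.continuous.tendsto F).comp hF) hre, p, hpM, hF⟩

/-! ### Outer functions -/

/-- The real part determines an element of `realMeanHardy`, so `F` is itself the limit of
polynomials with real parts at most `M + 1`. Their exponentials are uniformly bounded, and dominated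
convergence applies along a subsequence. -/
theorem IsHardy.exp_mul {f : Torus → ℂ} (hf : IsHardy f) {F : Lp ℂ 2 torusMeasure}
    (hF : F ∈ realMeanHardy) {M : ℝ} (hM : ∀ᵐ t ∂torusMeasure, (F t).re ≤ M) :
    IsHardy (fun t => Complex.exp (F t) * f t) := by
  obtain ⟨F', hF', hre, p, hp, hlim⟩ := exists_realMeanHardy_of_le (reLp F) (M := M) (by
    filter_upwards [coeFn_reLp F, hM] with t h1 h2
    rwa [h1])
  obtain rfl : F = F' := by
    have h := norm_le_of_mem_realMeanHardy (realMeanHardy.sub_mem hF hF')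
    rw [map_sub, hre, sub_self, norm_zero, mul_zero] at h
    exact sub_eq_zero.1 (norm_le_zero_iff.1 h)
  obtain ⟨ns, -, hns⟩ := (tendstoInMeasure_of_tendsto_Lp hlim).exists_seq_tendsto_ae
  refine IsHardy.of_tendsto (fun t => Real.exp (M + 1) * ‖f t‖)
    (fun n => hf.exp_polynomial_mul (p (ns n))) (hf.1.norm.const_mul _)
    (fun n => ae_of_all _ fun t => ?_) ?_
  · rw [norm_mul, Complex.norm_exp]
    gcongr
    exact hp _ t
  · filter_upwards [hns, ae_all_iff.2 fun n => coeFn_circlePolynomialLp (p (ns n))] with t h1 h2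
    simp only [h2] at h1
    exact ((Complex.continuous_exp.tendsto _).comp h1).mul_const _

/-- A sequence of analytic functions with nonpositive real parts, tending to zero, which cut a given
square-integrable function off at integer heights. -/
theorem exists_cutoff {l : Torus → ℝ} (hl : MemLp l 2 torusMeasure) :
    ∃ (Φ : ℕ → Lp ℂ 2 torusMeasure) (k : ℕ → ℕ), (∀ n, Φ n ∈ realMeanHardy) ∧
      (∀ n, ∀ᵐ t ∂torusMeasure, (Φ n t).re = min 0 ((k n : ℝ) - l t)) ∧
      ∀ᵐ t ∂torusMeasure, Tendsto (fun n => Φ n t) atTop (𝓝 0) := by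
  have habs : ∀ (n : ℕ) (t : Torus), |min 0 ((n : ℝ) - l t)| ≤ |l t| := fun n t => by
    have hn : (0 : ℝ) ≤ n := n.cast_nonneg
    rw [abs_of_nonpos (min_le_left _ _)]
    rcases le_total 0 ((n : ℝ) - l t) with h | h
    · rw [min_eq_left h]; simp
    · rw [min_eq_right h]
      linarith [le_abs_self (l t)]
  have hmem : ∀ n : ℕ, MemLp (fun t => min 0 ((n : ℝ) - l t)) 2 torusMeasure := fun n =>
    hl.of_le (aestronglyMeasurable_const.inf (aestronglyMeasurable_const.sub hl.1))
      (ae_of_all _ (habs n))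
  choose Φ hΦ hre _ using fun n => exists_realMeanHardy_of_le ((hmem n).toLp _) (M := 0) (by
    filter_upwards [(hmem n).coeFn_toLp] with t ht
    rw [ht]
    exact min_le_left _ _)
  have hnorm : Tendsto (fun n => ‖(hmem n).toLp _‖ ^ 2) atTop (𝓝 0) := by
    have hd := tendsto_integral_of_dominated_convergence (μ := torusMeasure)
      (F := fun (n : ℕ) t => (min 0 ((n : ℝ) - l t)) ^ 2) (f := fun _ => 0) (fun t => (l t) ^ 2)
      (fun n => (hmem n).integrable_sq.1) hl.integrable_sq
      (fun n => ae_of_all _ fun t => by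
        rw [Real.norm_eq_abs, abs_pow, ← sq_abs (l t)]
        exact pow_le_pow_left₀ (abs_nonneg _) (habs n t) 2)
      (ae_of_all _ fun t => by
        obtain ⟨N, hN⟩ := exists_nat_ge (l t)
        refine tendsto_const_nhds.congr' ?_
        filter_upwards [eventually_ge_atTop N] with n hn
        have : (N : ℝ) ≤ n := by exact_mod_cast hn
        rw [min_eq_left (by linarith)]
        simp)
    rw [integral_zero] at hd
    refine hd.congr fun n => ?_
    rw [norm_sq_eq_integral]
    refine integral_congr_ae ?_
    filter_upwards [(hmem n).coeFn_toLp] with t ht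
    rw [ht, Real.norm_eq_abs, sq_abs]
  have hlim : Tendsto Φ atTop (𝓝 0) := by
    rw [tendsto_zero_iff_norm_tendsto_zero]
    have hsq : Tendsto (fun n => ‖Φ n‖ ^ 2) atTop (𝓝 0) := by
      refine squeeze_zero (fun _ => by positivity)
        (fun n => norm_sq_le_of_mem_realMeanHardy (hΦ n)) ?_
      simp only [hre]
      simpa using hnorm.const_mul 2
    have := (Real.continuous_sqrt.tendsto 0).comp hsq
    simpa [Function.comp_def] using this
  -- Convergence in `L²` is almost everywhere only along a subsequence, hence the heights `k n`.
  obtain ⟨k, -, hk⟩ := (tendstoInMeasure_of_tendsto_Lp hlim).exists_seq_tendsto_ae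
  refine ⟨fun n => Φ (k n), k, fun n => hΦ _, fun n => ?_, ?_⟩
  · have h := coeFn_reLp (Φ (k n))
    rw [hre] at h
    filter_upwards [h, (hmem (k n)).coeFn_toLp] with t h1 h2
    rw [← h1, h2]
  · filter_upwards [hk, Lp.coeFn_zero ℂ 2 torusMeasure] with t h1 h2
    simpa only [h2, Pi.zero_apply] using h1

/-- `Re F` may be unbounded above, but `Re (F + Φ n) = min (Re F) (k n)` is not. The cut-off
exponentials are dominated by `|exp F|`. -/
theorem isHardy_exp {F : Lp ℂ 2 torusMeasure} (hF : F ∈ realMeanHardy)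
    (hint : Integrable (fun t => Complex.exp (F t)) torusMeasure) :
    IsHardy (fun t => Complex.exp (F t)) := by
  obtain ⟨Φ, k, hΦ, hre, hlim⟩ := exists_cutoff (Lp.memLp F).re
  have hsum : ∀ n, IsHardy (fun t => Complex.exp (F t) * Complex.exp (Φ n t)) := fun n => by
    refine (isHardy_one.exp_mul (realMeanHardy.add_mem hF (hΦ n)) (M := k n) ?_).congr ?_
    · filter_upwards [Lp.coeFn_add F (Φ n), hre n] with t h1 h2
      rw [h1, Pi.add_apply, Complex.add_re, h2]
      have := min_le_right 0 ((k n : ℝ) - RCLike.re (F t))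
      simp only [RCLike.re_to_complex] at this ⊢
      linarith
    · filter_upwards [Lp.coeFn_add F (Φ n)] with t h1
      rw [h1, Pi.add_apply, Complex.exp_add, mul_one]
  refine IsHardy.of_tendsto _ hsum hint.norm (fun n => ?_) ?_
  · filter_upwards [hre n] with t ht
    rw [norm_mul, Complex.norm_exp (Φ n t), ht]
    exact mul_le_of_le_one_right (norm_nonneg _) (Real.exp_le_one_iff.2 (min_le_left _ _))
  · filter_upwards [hlim] with t ht
    simpa using ((Complex.continuous_exp.tendsto _).comp ht).const_mul (Complex.exp (F t))

/-- The logarithm lies between `log δ` and `2√w`, and `√w` is in `L²` because `w` is integrable. -/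
theorem memLp_two_log {w : Torus → ℝ} (hw : Integrable w torusMeasure) {δ : ℝ} (hδ : 0 < δ)
    (h : ∀ t, δ ≤ w t) : MemLp (fun t => Real.log (w t)) 2 torusMeasure := by
  have hsqrt : MemLp (fun t => √(w t)) 2 torusMeasure := by
    rw [memLp_two_iff_integrable_sq (Real.continuous_sqrt.comp_aestronglyMeasurable hw.1)]
    exact hw.congr (ae_of_all _ fun t => (Real.sq_sqrt (hδ.le.trans (h t))).symm)
  refine ((hsqrt.const_mul 2).add (memLp_const |Real.log δ|)).of_le
    (Real.measurable_log.comp_aemeasurable hw.1.aemeasurable).aestronglyMeasurable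
    (ae_of_all _ fun t => ?_)
  have hpos : 0 < w t := hδ.trans_le (h t)
  have h1 : Real.log (w t) ≤ 2 * √(w t) := by
    have := Real.log_le_self (Real.sqrt_nonneg (w t))
    rw [Real.log_sqrt hpos.le] at this
    linarith
  have h2 := Real.log_le_log hδ (h t)
  have h3 := Real.sqrt_nonneg (w t)
  have h4 := abs_nonneg (Real.log δ)
  have h5 := neg_abs_le (Real.log δ)
  rw [Pi.add_apply, Real.norm_eq_abs, Real.norm_eq_abs, abs_of_nonneg (a := _ + _) (by positivity),
    abs_le]
  constructor <;> linarith

/-- An integrable function bounded away from zero is the modulus of an outer function of `H¹`. -/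
theorem exists_outer {w : Torus → ℝ} (hw : Integrable w torusMeasure) {δ : ℝ} (hδ : 0 < δ)
    (h : ∀ t, δ ≤ w t) :
    ∃ F : Lp ℂ 2 torusMeasure, IsHardy (fun t => Complex.exp (F t)) ∧
      (∀ᵐ t ∂torusMeasure, ‖Complex.exp (F t)‖ = w t) ∧
      ∀ f : Torus → ℂ, IsHardy f → IsHardy (fun t => Complex.exp (-F t) * f t) := by
  have hlog := (memLp_two_log hw hδ h).neg
  -- `log w` need not be bounded above, but `-log w` is, by `-log δ`. So the logarithm of the
  -- reciprocal is built first, and `F = -E`; division by `exp F` is then multiplication by the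
  -- bounded `exp E`.
  obtain ⟨E, hE, hre, -⟩ := exists_realMeanHardy_of_le (hlog.toLp _) (M := -Real.log δ) (by
    filter_upwards [hlog.coeFn_toLp] with t ht
    rw [ht]
    exact neg_le_neg (Real.log_le_log hδ (h t)))
  have hEre : ∀ᵐ t ∂torusMeasure, (E t).re = -Real.log (w t) := by
    have h1 := coeFn_reLp E
    rw [hre] at h1
    filter_upwards [h1, hlog.coeFn_toLp] with t h2 h3
    rw [← h2, h3, Pi.neg_apply]
  have hneg : ∀ᵐ t ∂torusMeasure, (-E : Lp ℂ 2 torusMeasure) t = -E t := Lp.coeFn_neg E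
  have hmod : ∀ᵐ t ∂torusMeasure, ‖Complex.exp ((-E : Lp ℂ 2 torusMeasure) t)‖ = w t := by
    filter_upwards [hEre, hneg] with t h1 h2
    rw [h2, Complex.norm_exp, Complex.neg_re, h1, neg_neg, Real.exp_log (hδ.trans_le (h t))]
  refine ⟨-E, isHardy_exp (realMeanHardy.neg_mem hE) ?_, hmod, fun f hf => ?_⟩
  · exact hw.mono' (Complex.continuous_exp.comp_aestronglyMeasurable (Lp.aestronglyMeasurable _))
      (hmod.mono fun t ht => ht.le)
  · refine (hf.exp_mul hE (M := -Real.log δ) ?_).congr ?_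
    · filter_upwards [hEre] with t ht
      rw [ht]
      exact neg_le_neg (Real.log_le_log hδ (h t))
    · filter_upwards [hneg] with t ht
      rw [ht, neg_neg]

/-- If the product of two functions of `H¹` is integrable, it belongs to `H¹`. -/
theorem IsHardy.mul {g h : Torus → ℂ} (hg : IsHardy g) (hh : IsHardy h)
    (hint : Integrable (fun t => g t * h t) torusMeasure) : IsHardy (fun t => g t * h t) := by
  have hw1 : ∀ t, 1 ≤ 1 + ‖g t‖ + ‖h t‖ := fun t => by
    linarith [norm_nonneg (g t), norm_nonneg (h t)]
  have hw : Integrable (fun t => 1 + ‖g t‖ + ‖h t‖) torusMeasure :=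
    ((integrable_const 1).add hg.1.norm).add hh.1.norm
  -- With `w = 1 + |g| + |h|`, `|exp (Φ n)| w ≤ e^{k n}`, so both factors become bounded and the
  -- `H²` case applies. The products `exp (2 Φ n) g h` are dominated by `|g h|`.
  obtain ⟨Φ, k, hΦ, hre, hlim⟩ := exists_cutoff (memLp_two_log hw one_pos hw1)
  have hbdd : ∀ n, ∀ f : Torus → ℂ, IsHardy f → (∀ t, ‖f t‖ ≤ 1 + ‖g t‖ + ‖h t‖) →
      IsHardy (fun t => Complex.exp (Φ n t) * f t) ∧
      MemLp (fun t => Complex.exp (Φ n t) * f t) 2 torusMeasure := fun n f hf hfw => by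
    have hH : IsHardy (fun t => Complex.exp (Φ n t) * f t) := by
      refine hf.exp_mul (hΦ n) (M := 0) ?_
      filter_upwards [hre n] with t ht
      rw [ht]
      exact min_le_left _ _
    refine ⟨hH, MemLp.of_bound hH.1.1 (Real.exp (k n)) ?_⟩
    filter_upwards [hre n] with t ht
    have hpos : 0 < 1 + ‖g t‖ + ‖h t‖ := one_pos.trans_le (hw1 t)
    rw [norm_mul, Complex.norm_exp, ht]
    calc _ ≤ Real.exp ((k n : ℝ) - Real.log (1 + ‖g t‖ + ‖h t‖)) * (1 + ‖g t‖ + ‖h t‖) := by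
          gcongr
          · exact min_le_right _ _
          · exact hfw t
      _ = Real.exp (k n) := by rw [Real.exp_sub, Real.exp_log hpos, div_mul_cancel₀ _ hpos.ne']
  have hprod := fun n =>
    (hbdd n g hg fun t => by linarith [norm_nonneg (h t)]).1.mul_of_memLp_two
      (hbdd n h hh fun t => by linarith [norm_nonneg (g t)]).1
      (hbdd n g hg fun t => by linarith [norm_nonneg (h t)]).2
      (hbdd n h hh fun t => by linarith [norm_nonneg (g t)]).2
  refine IsHardy.of_tendsto _ hprod hint.norm (fun n => ?_) ?_
  · filter_upwards [hre n] with t ht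
    have h1 : ‖Complex.exp (Φ n t)‖ ≤ 1 := by
      rw [Complex.norm_exp, ht]
      exact Real.exp_le_one_iff.2 (min_le_left _ _)
    simp only [norm_mul]
    exact mul_le_mul (mul_le_of_le_one_left (norm_nonneg _) h1)
      (mul_le_of_le_one_left (norm_nonneg _) h1) (by positivity) (norm_nonneg _)
  · filter_upwards [hlim] with t ht
    have h1 := (Complex.continuous_exp.tendsto _).comp ht
    simpa using (h1.mul_const (g t)).mul (h1.mul_const (h t))

/-! ### Factorization in Hardy spaces of Banach function spaces -/

namespace FunctionClass

theorem IsBanachFunctionSpace.one_mem {X : FunctionClass} (hX : X.IsBanachFunctionSpace) :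
    (1 : LZero) ∈ X.carrier :=
  hX.linfty_subset 1 ((memLp_const (1 : ℂ)).ae_eq AEEqFun.coeFn_one.symm)

theorem SubsetLOne.left {X Y : FunctionClass} (hXY : (X.prod Y).SubsetLOne)
    (hY : Y.IsBanachFunctionSpace) : X.SubsetLOne :=
  fun g hg => hXY g ⟨g, hg, 1, hY.one_mem, (mul_one g).symm⟩

theorem SubsetLOne.isHardy_mul {X Y : FunctionClass} (hXY : (X.prod Y).SubsetLOne) {g h : LZero}
    (hg : g ∈ X.hardy.carrier) (hh : h ∈ Y.hardy.carrier) : IsHardy (g * h : LZero) := by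
  have hcoe := AEEqFun.coeFn_mul g h
  have hint : Integrable (g * h : LZero) torusMeasure := hXY _ ⟨g, hg.1, h, hh.1, rfl⟩
  exact (IsHardy.mul hg.2 hh.2 (hint.congr hcoe)).congr hcoe.symm

/-- A function dominated by `|g| + δ` has norm at most `‖g‖ + δ ‖1‖`. -/
theorem IsBanachFunctionSpace.mem_of_norm_le_add {X : FunctionClass}
    (hX : X.IsBanachFunctionSpace) {g G : LZero} (hg : g ∈ X.carrier) {δ : ℝ} (hδ : 0 ≤ δ)
    (hG : ∀ᵐ t ∂torusMeasure, ‖G t‖ ≤ ‖g t‖ + δ) :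
    G ∈ X.carrier ∧ X.nrm G ≤ X.nrm g + δ * X.nrm 1 := by
  -- The triangle inequality needs an actual sum of modulus `|g| + δ`, hence `|g|` in place of `g`.
  let a : LZero := AEEqFun.mk (fun t => ((‖g t‖ : ℝ) : ℂ))
    (Complex.continuous_ofReal.comp_aestronglyMeasurable g.aestronglyMeasurable.norm)
  have ha : ∀ᵐ t ∂torusMeasure, a t = ((‖g t‖ : ℝ) : ℂ) := AEEqFun.coeFn_mk _ _
  obtain ⟨haX, hale⟩ := hX.ideal g hg a (by
    filter_upwards [ha] with t ht
    rw [ht, Complex.norm_real, norm_norm])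
  have h1 := hX.smul_mem (δ : ℂ) 1 hX.one_mem
  obtain ⟨hGX, hGle⟩ := hX.ideal _ (hX.add_mem a haX _ h1) G (by
    filter_upwards [ha, hG, AEEqFun.coeFn_add a ((δ : ℂ) • (1 : LZero)),
      AEEqFun.coeFn_smul (δ : ℂ) (1 : LZero),
      AEEqFun.coeFn_one (α := Torus) (β := ℂ) (μ := torusMeasure)] with t h2 h3 h4 h5 h6
    rw [h4, Pi.add_apply, h5, Pi.smul_apply, h6, h2, Pi.one_apply, smul_eq_mul, mul_one,
      ← Complex.ofReal_add, Complex.norm_real, Real.norm_of_nonneg (by positivity)]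
    exact h3)
  refine ⟨hGX, hGle.trans ((hX.nrm_add_le a haX _ h1).trans ?_)⟩
  rw [hX.nrm_smul _ _ hX.one_mem, Complex.norm_real, Real.norm_of_nonneg hδ]
  linarith

/-- An analytic product `g h` with `g ∈ X`, `h ∈ Y` factors into analytic functions of `X` and `Y`,
with almost the same norms. -/
theorem exists_hardy_factorization {X Y : FunctionClass} (hX : X.IsBanachFunctionSpace)
    (hY : Y.IsBanachFunctionSpace) (hX1 : X.SubsetLOne) {g h : LZero} (hg : g ∈ X.carrier)
    (hh : h ∈ Y.carrier) (hgh : IsHardy (g * h : LZero)) {δ : ℝ} (hδ : 0 < δ) :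
    ∃ G ∈ X.hardy.carrier, ∃ H ∈ Y.hardy.carrier, g * h = G * H ∧
      X.nrm G ≤ X.nrm g + δ * X.nrm 1 ∧ Y.nrm H ≤ Y.nrm h := by
  obtain ⟨F, hF, hmod, hmul⟩ := exists_outer (w := fun t => max ‖g t‖ δ)
    ((hX1 g hg).norm.sup (integrable_const δ)) hδ (fun t => le_max_right _ _)
  have hQ := hmul _ hgh
  let G : LZero := AEEqFun.mk _ hF.1.1
  let H : LZero := AEEqFun.mk _ hQ.1.1
  have hG : ∀ᵐ t ∂torusMeasure, G t = Complex.exp (F t) := AEEqFun.coeFn_mk _ _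
  have hH : ∀ᵐ t ∂torusMeasure, H t = Complex.exp (-F t) * (g * h : LZero) t :=
    AEEqFun.coeFn_mk _ _
  obtain ⟨hGX, hGle⟩ := hX.mem_of_norm_le_add (G := G) hg hδ.le (by
    filter_upwards [hG, hmod] with t h1 h2
    rw [h1, h2]
    exact max_le_add_of_nonneg (norm_nonneg _) hδ.le)
  -- `|H| = |g| |h| / max(|g|, δ) ≤ |h|`, so the whole loss in norm falls on `G`.
  obtain ⟨hHY, hHle⟩ := hY.ideal h hh H (by
    filter_upwards [hH, hmod, AEEqFun.coeFn_mul g h] with t h1 h2 h3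
    have hpos : 0 < max ‖g t‖ δ := hδ.trans_le (le_max_right _ _)
    rw [h1, h3, Pi.mul_apply, Complex.exp_neg, norm_mul, norm_mul, norm_inv, h2,
      inv_mul_le_iff₀ hpos]
    gcongr
    exact le_max_left _ _)
  refine ⟨G, ⟨hGX, hF.congr (EventuallyEq.symm hG)⟩, H, ⟨hHY, hQ.congr (EventuallyEq.symm hH)⟩,
    AEEqFun.ext ?_, hGle, hHle⟩
  filter_upwards [hG, hH, AEEqFun.coeFn_mul G H] with t h1 h2 h3
  rw [h3, Pi.mul_apply, h1, h2, ← mul_assoc, ← Complex.exp_add, add_neg_cancel, Complex.exp_zero,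
    one_mul]

end FunctionClass

theorem theorem5p1 (X Y : FunctionClass)
    (hX : X.IsBanachFunctionSpace) (hXri : X.IsRearrangementInvariant)
    (hY : Y.IsBanachFunctionSpace) (hYri : Y.IsRearrangementInvariant)
    (hXY : (X.prod Y).SubsetLOne) :
    (X.hardy.prod Y.hardy).IsometricallyEqual (X.prod Y).hardy := by
  have hX1 : X.SubsetLOne := hXY.left hY
  have hsub : ∀ f ∈ (X.hardy.prod Y.hardy).carrier, f ∈ (X.prod Y).hardy.carrier := by
    rintro _ ⟨g, hg, h, hh, rfl⟩
    exact ⟨⟨g, hg.1, h, hh.1, rfl⟩, hXY.isHardy_mul hg hh⟩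
  refine ⟨Set.Subset.antisymm hsub ?_, fun f hf => le_antisymm ?_ ?_⟩
  · rintro _ ⟨⟨g, hg, h, hh, rfl⟩, hgh⟩
    obtain ⟨G, hG, H, hH, heq, -⟩ :=
      FunctionClass.exists_hardy_factorization hX hY hX1 hg hh hgh one_pos
    exact ⟨G, hG, H, hH, heq⟩
  · have hfH : IsHardy f := (hsub f hf).2
    obtain ⟨g₀, hg₀, h₀, hh₀, hf₀⟩ := (hsub f hf).1
    -- The real infimum of an empty set is `0` by convention, so a factorization must be exhibited.
    refine le_csInf ⟨_, g₀, hg₀, h₀, hh₀, hf₀, rfl⟩ ?_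
    rintro _ ⟨g, hg, h, hh, rfl, rfl⟩
    have hbound : ∀ δ : ℝ, 0 < δ → (X.hardy.prod Y.hardy).nrm (g * h) ≤
        (X.nrm g + δ * X.nrm 1) * Y.nrm h := fun δ hδ => by
      obtain ⟨G, hG, H, hH, heq, hGle, hHle⟩ :=
        FunctionClass.exists_hardy_factorization hX hY hX1 hg hh hfH hδ
      refine le_trans (b := X.nrm G * Y.nrm H)
        (csInf_le ⟨0, ?_⟩ ⟨G, hG, H, hH, heq, rfl⟩) ?_
      · rintro _ ⟨a, ha, b, hb, -, rfl⟩
        exact mul_nonneg (hX.nrm_nonneg a ha.1) (hY.nrm_nonneg b hb.1)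
      · exact mul_le_mul hGle hHle (hY.nrm_nonneg H hH.1)
          ((hX.nrm_nonneg G hG.1).trans hGle)
    have hlim : Tendsto (fun δ : ℝ => (X.nrm g + δ * X.nrm 1) * Y.nrm h) (𝓝[>] 0)
        (𝓝 (X.nrm g * Y.nrm h)) := by
      have hc : Continuous fun δ : ℝ => (X.nrm g + δ * X.nrm 1) * Y.nrm h := by fun_prop
      simpa using (hc.tendsto 0).mono_left nhdsWithin_le_nhds
    exact ge_of_tendsto hlim (eventually_mem_nhdsWithin.mono fun δ hδ => hbound δ hδ)
  -- Analytic factorizations are among all factorizations, so their infimum is at least as large.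
  · obtain ⟨g₀, hg₀, h₀, hh₀, hf₀⟩ := hf
    refine csInf_le_csInf ⟨0, ?_⟩ ⟨_, g₀, hg₀, h₀, hh₀, hf₀, rfl⟩ ?_
    · rintro _ ⟨a, ha, b, hb, -, rfl⟩
      exact mul_nonneg (hX.nrm_nonneg a ha) (hY.nrm_nonneg b hb)
    · rintro _ ⟨g, hg, h, hh, heq, rfl⟩
      exact ⟨g, hg.1, h, hh.1, heq, rfl⟩
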